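/- Fix an integer $d_v\ge 3$, an integer $d_r$, nonnegative reals $\rho_2,\dots,\rho_{d_r}$ with $\sum_{j=2}^{d_r}\rho_j=1$ ($\rho_j$ is the fraction of edges of the Tanner graph that belong to check nodes of degree $j$), and a code rate $R>0$. Define $\phi(0)=1$ and $$\phi(x)=1-\frac{1}{\sqrt{4\pi x}}\int_{\mathbb R}\tanh\frac u2\; e^{-\frac{(u-x)^2}{4x}}\,du\qquad(x>0),$$ and let $\phi^{-1}:(0,1]\to[0,\infty)$ be the inverse of $\phi:[0,\infty)\to(0,1]$. For $E_b/N_0>0$ (a linear ratio) put $m_\lambda=4R\,E_b/N_0$. Density evolution under the consistent Gaussian approximation for the log-domain sum-product decoder of a variable-regular, check-irregular $(d_v,\rho(x))$ LDPC code on the binary-input AWGN channel is the recursion $m^{(0)}=0$ and, for $l\ge1$, $$m_j^{(l)}=\phi^{-1}\!\left(1-\left[1-\phi\!\left(m_\lambda+(d_v-1)m^{(l-1)}\right)\right]^{j-1}\right),\qquad m^{(l)}=\sum_{j=2}^{d_r}\rho_j\,m_j^{(l)},$$ where $m^{(l)}$ is the check node output mean at iteration $l$. Put $\delta_j^{(l)}=1-3/m_j^{(l)}$,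 and say that the SNR condition holds at iteration $l\ge 1$ if $m_j^{(l)}>3$ for all $j$ with $\rho_j\ne0$ and $$R\,\frac{E_b}{N_0}>\sum_{j=2}^{d_r}\rho_j\ln\frac{j-1}{\delta_j^{(l)}}$$ (terms with $\rho_j=0$ are omitted). **Theorem.** (a) There are a threshold $e_0>0$ and a constant $C>0$, depending only on $d_v$, $\rho$ and $R$, such that for every $E_b/N_0>e_0$ there is an $L\ge1$ such that the SNR condition holds at iteration $L$ and $m^{(l)}>C(d_v-1)^l$ for all $l\ge L$. (b) For every $E_b/N_0>0$, if the SNR condition holds at some iteration $l_0\ge1$, then $m^{(l)}>(d_v-1)\,m^{(l-1)}$ for all $l\ge l_0$, and there is a $C>0$ such that $m^{(l)}>C(d_v-1)^l$ for all $l\ge l_0$. -/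

import Mathlib

noncomputable section

namespace DensityEvolution

/-- The function `φ` of the consistent Gaussian approximation: for `x > 0`, one minus the
expectation of `tanh (u / 2)` for `u ∼ N(x, 2x)`, and `φ 0 = 1`. Only `x ≥ 0` matters. -/
def phi (x : ℝ) : ℝ :=
  if 0 < x then
    1 - 1 / √(4 * Real.pi * x) *
      ∫ u : ℝ, Real.tanh (u / 2) * Real.exp (-((u - x) ^ 2 / (4 * x)))
  else 1

/-- The inverse of `φ`, regarded as a function on `[0, ∞)`. -/
def phiInv (y : ℝ) : ℝ := Function.invFunOn phi (Set.Ici 0) y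

/-- Mean of the channel LLR on the binary-input AWGN channel with code rate `R` and
`E_b / N_0 = e` (a linear ratio, not dB). -/
def channelMean (R e : ℝ) : ℝ := 4 * R * e

/-- Mean of a variable-to-check message: channel LLR plus `d_v - 1` check outputs of mean `m`. -/
def variableMean (dv : ℕ) (mch m : ℝ) : ℝ := mch + ((dv : ℝ) - 1) * m

/-- Output mean of a check node of degree `j` whose inputs have mean `x`. -/
def checkMean (j : ℕ) (x : ℝ) : ℝ := phiInv (1 - (1 - phi x) ^ (j - 1))

/-- The check node output mean `m^(l)` after `l` iterations, averaged over the edges. Here `ρ j` is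
the fraction of edges that belong to check nodes of degree `j`, `2 ≤ j ≤ dr`. Before the first
iteration there are no check messages, so the mean is `0`. -/
def mean (dv dr : ℕ) (ρ : ℕ → ℝ) (R e : ℝ) : ℕ → ℝ
  | 0 => 0
  | l + 1 => ∑ j ∈ Finset.Icc 2 dr,
      ρ j * checkMean j (variableMean dv (channelMean R e) (mean dv dr ρ R e l))

/-- The output mean `m_j^(l)` of the check nodes of degree `j` at iteration `l`. -/
def degreeMean (dv dr : ℕ) (ρ : ℕ → ℝ) (R e : ℝ) (j : ℕ) : ℕ → ℝ
  | 0 => 0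
  | l + 1 => checkMean j (variableMean dv (channelMean R e) (mean dv dr ρ R e l))

/-- `δ_j = 1 - 3 / m_j^(l)`. -/
def delta (dv dr : ℕ) (ρ : ℕ → ℝ) (R e : ℝ) (j l : ℕ) : ℝ :=
  1 - 3 / degreeMean dv dr ρ R e j l

/-- The SNR condition at iteration `l`: `m_j^(l) > 3` (so that `0 < δ_j < 1`) for every check
degree `j` that occurs, and `R E_b / N_0 > ∑ j, ρ_j ln ((j - 1) / δ_j)`. -/
def GrowthCondition (dv dr : ℕ) (ρ : ℕ → ℝ) (R e : ℝ) (l : ℕ) : Prop :=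
  (∀ j ∈ Finset.Icc 2 dr, ρ j ≠ 0 → 3 < degreeMean dv dr ρ R e j l) ∧
    ∑ j ∈ Finset.Icc 2 dr, ρ j * Real.log (((j : ℝ) - 1) / delta dv dr ρ R e j l) < R * e

end DensityEvolution

end

open MeasureTheory Filter Topology Real

namespace DensityEvolution

/-! Since `1 - tanh (u/2) = e^(-u/2) sech (u/2)`, completing the square turns `φ` into `e^(-x/4)
S(x) / √π`, where `S = sechAverage`. This form shows that `φ` decreases strictly from `1` to `0`.
Rescaling gives `π (1 - 3/x) ≤ √x S(x) ≤ π`, so `φ` is known up to the factor `1 - 3/x`.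

At a check node with input mean `x`, Bernoulli's inequality gives `φ(m_j) ≤ (j-1) φ(x)`. The
two-sided bound converts this into a bounded loss, `x - m_j ≤ 4 ln ((j-1)/δ_j)`
(`sub_checkMean_le`). Averaged over `ρ`, the SNR condition says precisely that this bound on the
loss is below the channel mean `4 R E_b/N_0`. As `x` is the channel mean plus `(d_v-1) m^(l-1)`,
what survives exceeds `(d_v-1) m^(l-1)` (`GrowthCondition.mul_mean_lt`).

All means are nondecreasing in `l`, so the condition persists once it holds, and the growth
iterates. At high SNR it already holds at `l = 1`. -/

/-! ### The closed form of `φ` -/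

/-- The Gaussian average `∫ sech (√x v) e^{-v²} dv`. -/
noncomputable def sechAverage (x : ℝ) : ℝ := ∫ v : ℝ, (cosh (√x * v))⁻¹ * exp (-v ^ 2)

lemma integrable_exp_neg_sq : Integrable fun v : ℝ => exp (-v ^ 2) := by
  simpa using integrable_exp_neg_mul_sq (b := 1) one_pos

lemma integrable_sech_mul_exp_neg_sq (a : ℝ) :
    Integrable fun v : ℝ => (cosh (a * v))⁻¹ * exp (-v ^ 2) := by
  have hcont : Continuous fun v : ℝ => (cosh (a * v))⁻¹ :=
    Continuous.inv₀ (by fun_prop) fun v => (cosh_pos _).ne'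
  refine integrable_exp_neg_sq.mono' (by fun_prop) (ae_of_all _ fun v => ?_)
  have h1 : (cosh (a * v))⁻¹ ≤ 1 := inv_le_one_of_one_le₀ (one_le_cosh _)
  have h0 : 0 ≤ (cosh (a * v))⁻¹ := inv_nonneg.2 (cosh_pos _).le
  rw [norm_of_nonneg (by positivity)]
  exact mul_le_of_le_one_left (exp_pos _).le h1

lemma sechAverage_zero : sechAverage 0 = √π := by
  simpa [sechAverage] using integral_gaussian 1

lemma sechAverage_pos (x : ℝ) : 0 < sechAverage x := by
  have hpos (v : ℝ) : 0 < (cosh (√x * v))⁻¹ * exp (-v ^ 2) :=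
    mul_pos (inv_pos.2 (cosh_pos _)) (exp_pos _)
  refine (integral_pos_iff_support_of_nonneg (fun v => (hpos v).le)
    (integrable_sech_mul_exp_neg_sq _)).2 ?_
  rw [Function.support_eq_univ fun v => (hpos v).ne']
  simp

lemma sechAverage_antitone : Antitone sechAverage := by
  intro x y hxy
  refine integral_mono (integrable_sech_mul_exp_neg_sq _) (integrable_sech_mul_exp_neg_sq _)
    fun v => ?_
  refine mul_le_mul_of_nonneg_right (inv_anti₀ (cosh_pos _) (cosh_le_cosh.2 ?_)) (exp_pos _).le
  rw [abs_mul, abs_mul, abs_of_nonneg (sqrt_nonneg _), abs_of_nonneg (sqrt_nonneg _)]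
  exact mul_le_mul_of_nonneg_right (sqrt_le_sqrt hxy) (abs_nonneg _)

lemma continuous_sechAverage : Continuous sechAverage := by
  refine continuous_of_dominated (bound := fun v => exp (-v ^ 2))
    (fun x => (integrable_sech_mul_exp_neg_sq _).aestronglyMeasurable) (fun x => ?_)
    integrable_exp_neg_sq (ae_of_all _ fun v => ?_)
  · refine ae_of_all _ fun v => ?_
    have h1 : (cosh (√x * v))⁻¹ ≤ 1 := inv_le_one_of_one_le₀ (one_le_cosh _)
    have h0 : 0 ≤ (cosh (√x * v))⁻¹ := inv_nonneg.2 (cosh_pos _).le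
    rw [norm_of_nonneg (by positivity)]
    exact mul_le_of_le_one_left (exp_pos _).le h1
  · exact (Continuous.inv₀ (by fun_prop) fun x => (cosh_pos _).ne').mul continuous_const

/-- The exponent `-(u-x)²/(4x)` expands to `-x/4 + u/2 - u²/(4x)`, and its factor `e^(u/2)` cancels
the `e^(-u/2)` in `1 - tanh (u/2)`. -/
lemma one_sub_tanh_half_mul_exp {x : ℝ} (hx : 0 < x) (u : ℝ) :
    exp (-((u - x) ^ 2 / (4 * x))) - tanh (u / 2) * exp (-((u - x) ^ 2 / (4 * x))) =
      exp (-x / 4) * ((cosh (u / 2))⁻¹ * exp (-(u ^ 2 / (4 * x)))) := by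
  have hsub : cosh (u / 2) - sinh (u / 2) = exp (-(u / 2)) := cosh_sub_sinh _
  have hexp : exp (-((u - x) ^ 2 / (4 * x))) =
      exp (-x / 4) * exp (u / 2) * exp (-(u ^ 2 / (4 * x))) := by
    rw [← exp_add, ← exp_add]
    congr 1
    field_simp
    ring
  have hc := (cosh_pos (u / 2)).ne'
  have h1 : exp (-(u / 2)) * exp (u / 2) = 1 := by rw [← exp_add]; simp
  have h2 : 1 - tanh (u / 2) = exp (-(u / 2)) * (cosh (u / 2))⁻¹ := by
    rw [tanh_eq_sinh_div_cosh, ← hsub]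
    field_simp
  calc _ = (1 - tanh (u / 2)) * exp (-((u - x) ^ 2 / (4 * x))) := by ring
    _ = (exp (-(u / 2)) * exp (u / 2)) *
        (exp (-x / 4) * ((cosh (u / 2))⁻¹ * exp (-(u ^ 2 / (4 * x))))) := by rw [h2, hexp]; ring
    _ = _ := by rw [h1, one_mul]

/-- The leading `1` in `φ` is the normalized Gaussian mass, so it joins the `tanh` integral; the
substitution `u = 2√x v` then gives `sechAverage`. -/
lemma phi_eq_sechAverage {x : ℝ} (hx : 0 ≤ x) : phi x = exp (-x / 4) / √π * sechAverage x := by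
  have hpi : 0 < √π := sqrt_pos.2 pi_pos
  rcases hx.eq_or_lt with rfl | hx
  · simp [phi, sechAverage_zero, hpi.ne']
  have hs : 0 < √x := sqrt_pos.2 hx
  have hss : √x ^ 2 = x := sq_sqrt hx.le
  have hconst : √(4 * π * x) = √π * (2 * √x) := by
    rw [show 4 * π * x = π * (2 ^ 2 * x) by ring, sqrt_mul pi_pos.le, sqrt_mul (by norm_num),
      sqrt_sq (by norm_num)]
  have hG0 : Integrable fun u : ℝ => exp (-(u ^ 2 / (4 * x))) := by
    have := integrable_exp_neg_mul_sq (b := 1 / (4 * x)) (by positivity)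
    refine this.congr (ae_of_all _ fun u => ?_)
    ring_nf
  have hG : Integrable fun u : ℝ => exp (-((u - x) ^ 2 / (4 * x))) := hG0.comp_sub_right x
  have hGint : ∫ u : ℝ, exp (-((u - x) ^ 2 / (4 * x))) = √(4 * π * x) := by
    rw [integral_sub_right_eq_self (fun u : ℝ => exp (-(u ^ 2 / (4 * x)))) x]
    have := integral_gaussian (1 / (4 * x))
    rw [show π / (1 / (4 * x)) = 4 * π * x by field_simp] at this
    rw [← this]
    congr 1
    ext u
    congr 1
    ring
  have htanh : Continuous fun u : ℝ => tanh (u / 2) := by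
    simp_rw [tanh_eq_sinh_div_cosh]
    exact Continuous.div (by fun_prop) (by fun_prop) fun u => (cosh_pos _).ne'
  have hT : Integrable fun u : ℝ => tanh (u / 2) * exp (-((u - x) ^ 2 / (4 * x))) := by
    refine hG.mono' (by fun_prop) (ae_of_all _ fun u => ?_)
    rw [norm_mul, norm_of_nonneg (exp_pos _).le]
    exact mul_le_of_le_one_left (exp_pos _).le (abs_tanh_lt_one _).le
  have hscale : sechAverage x =
      (2 * √x)⁻¹ * ∫ u : ℝ, (cosh (u / 2))⁻¹ * exp (-(u ^ 2 / (4 * x))) := by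
    have := Measure.integral_comp_mul_left
      (fun u : ℝ => (cosh (u / 2))⁻¹ * exp (-(u ^ 2 / (4 * x)))) (2 * √x)
    rw [abs_of_pos (by positivity), smul_eq_mul] at this
    rw [← this, sechAverage]
    congr 1
    ext v
    rw [show 2 * √x * v / 2 = √x * v by ring,
      show (2 * √x * v) ^ 2 / (4 * x) = v ^ 2 by rw [mul_pow, mul_pow, hss]; field_simp; ring]
  have hmain : √(4 * π * x) - ∫ u : ℝ, tanh (u / 2) * exp (-((u - x) ^ 2 / (4 * x))) =
      exp (-x / 4) * ∫ u : ℝ, (cosh (u / 2))⁻¹ * exp (-(u ^ 2 / (4 * x))) := by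
    rw [← hGint, ← integral_sub hG hT, ← integral_const_mul]
    simp_rw [one_sub_tanh_half_mul_exp hx]
  have hne : √(4 * π * x) ≠ 0 := by rw [hconst]; positivity
  rw [phi, if_pos hx, hscale]
  calc _ = 1 / √(4 * π * x) *
        (√(4 * π * x) - ∫ u : ℝ, tanh (u / 2) * exp (-((u - x) ^ 2 / (4 * x)))) := by
          field_simp
    _ = _ := by
      rw [hmain, hconst]
      field_simp

/-! ### Monotonicity and inversion of `φ` -/

lemma phi_zero : phi 0 = 1 := by simp [phi]

lemma phi_pos {x : ℝ} (hx : 0 ≤ x) : 0 < phi x := by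
  rw [phi_eq_sechAverage hx]
  have := sechAverage_pos x
  have hpi := sqrt_pos.2 pi_pos
  positivity

lemma phi_strictAntiOn : StrictAntiOn phi (Set.Ici 0) := by
  intro x hx y hy hxy
  rw [phi_eq_sechAverage hx, phi_eq_sechAverage hy]
  have hpi := sqrt_pos.2 pi_pos
  have h1 : exp (-y / 4) < exp (-x / 4) := exp_lt_exp.2 (by linarith)
  exact mul_lt_mul (div_lt_div_of_pos_right h1 hpi) (sechAverage_antitone hxy.le)
    (sechAverage_pos y) (by positivity)

lemma phi_le_one {x : ℝ} (hx : 0 ≤ x) : phi x ≤ 1 :=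
  phi_zero ▸ phi_strictAntiOn.antitoneOn Set.self_mem_Ici hx hx

lemma continuousOn_phi : ContinuousOn phi (Set.Ici 0) := by
  have : Continuous fun x : ℝ => exp (-x / 4) / √π * sechAverage x := by
    have := continuous_sechAverage
    fun_prop
  exact this.continuousOn.congr fun x hx => phi_eq_sechAverage hx

lemma tendsto_phi_atTop : Tendsto phi atTop (𝓝 0) := by
  have hle : ∀ x : ℝ, 0 ≤ x → phi x ≤ exp (-x / 4) := fun x hx => by
    rw [phi_eq_sechAverage hx, div_mul_eq_mul_div, div_le_iff₀ (sqrt_pos.2 pi_pos)]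
    have := sechAverage_antitone hx
    rw [sechAverage_zero] at this
    gcongr
  have hlim : Tendsto (fun x : ℝ => exp (-x / 4)) atTop (𝓝 0) := by
    refine tendsto_exp_atBot.comp ?_
    exact tendsto_neg_atTop_atBot.atBot_div_const (by norm_num)
  refine squeeze_zero' ?_ ?_ hlim
  · filter_upwards [eventually_ge_atTop 0] with x hx using (phi_pos hx).le
  · filter_upwards [eventually_ge_atTop 0] with x hx using hle x hx

lemma exists_phi_eq {y : ℝ} (h0 : 0 < y) (h1 : y ≤ 1) : ∃ x ∈ Set.Ici (0 : ℝ), phi x = y := by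
  obtain ⟨b, hby, hb⟩ := ((tendsto_phi_atTop.eventually (gt_mem_nhds h0)).and
    (eventually_ge_atTop (0 : ℝ))).exists
  obtain ⟨x, hx, hxy⟩ := intermediate_value_Icc' hb
    (continuousOn_phi.mono Set.Icc_subset_Ici_self) ⟨hby.le, phi_zero ▸ h1⟩
  exact ⟨x, hx.1, hxy⟩

lemma phiInv_nonneg {y : ℝ} (h0 : 0 < y) (h1 : y ≤ 1) : 0 ≤ phiInv y :=
  Function.invFunOn_mem (exists_phi_eq h0 h1)

lemma phi_phiInv {y : ℝ} (h0 : 0 < y) (h1 : y ≤ 1) : phi (phiInv y) = y :=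
  Function.invFunOn_eq (exists_phi_eq h0 h1)

/-! ### The check node map -/

/-- The first bound is `p^(j-1) ≤ p` on `[0, 1]` and yields `m_j ≤ x`; the last is Bernoulli's
inequality and limits the loss `x - m_j`. -/
lemma checkMean_arg_mem {j : ℕ} (hj : 2 ≤ j) {x : ℝ} (hx : 0 ≤ x) :
    phi x ≤ 1 - (1 - phi x) ^ (j - 1) ∧ 1 - (1 - phi x) ^ (j - 1) ≤ 1 ∧
      1 - (1 - phi x) ^ (j - 1) ≤ ((j : ℝ) - 1) * phi x := by
  have h0 := phi_pos hx
  have h1 := phi_le_one hx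
  refine ⟨?_, ?_, ?_⟩
  · linarith [pow_le_of_le_one (sub_nonneg.2 h1) (by linarith) (by omega : j - 1 ≠ 0)]
  · linarith [pow_nonneg (sub_nonneg.2 h1) (j - 1)]
  · have := one_add_mul_le_pow (a := -phi x) (by linarith) (j - 1)
    rw [← sub_eq_add_neg, Nat.cast_sub (by omega), Nat.cast_one] at this
    linarith

lemma checkMean_nonneg {j : ℕ} (hj : 2 ≤ j) {x : ℝ} (hx : 0 ≤ x) : 0 ≤ checkMean j x :=
  have h := checkMean_arg_mem hj hx
  phiInv_nonneg ((phi_pos hx).trans_le h.1) h.2.1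

lemma phi_checkMean {j : ℕ} (hj : 2 ≤ j) {x : ℝ} (hx : 0 ≤ x) :
    phi (checkMean j x) = 1 - (1 - phi x) ^ (j - 1) :=
  have h := checkMean_arg_mem hj hx
  phi_phiInv ((phi_pos hx).trans_le h.1) h.2.1

lemma checkMean_le_self {j : ℕ} (hj : 2 ≤ j) {x : ℝ} (hx : 0 ≤ x) : checkMean j x ≤ x := by
  refine (phi_strictAntiOn.le_iff_ge hx (checkMean_nonneg hj hx)).1 ?_
  rw [phi_checkMean hj hx]
  exact (checkMean_arg_mem hj hx).1

lemma checkMean_mono {j : ℕ} (hj : 2 ≤ j) {x y : ℝ} (hx : 0 ≤ x) (hxy : x ≤ y) :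
    checkMean j x ≤ checkMean j y := by
  have hy := hx.trans hxy
  refine (phi_strictAntiOn.le_iff_ge (checkMean_nonneg hj hy) (checkMean_nonneg hj hx)).1 ?_
  rw [phi_checkMean hj hx, phi_checkMean hj hy]
  have := phi_strictAntiOn.antitoneOn hx hy hxy
  have h1 := phi_le_one hx
  gcongr

lemma eventually_lt_checkMean {j : ℕ} (hj : 2 ≤ j) {a : ℝ} (ha : 0 ≤ a) :
    ∀ᶠ x in atTop, a < checkMean j x := by
  have hlim : Tendsto (fun x => ((j : ℝ) - 1) * phi x) atTop (𝓝 0) := by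
    simpa using tendsto_phi_atTop.const_mul ((j : ℝ) - 1)
  filter_upwards [hlim.eventually (gt_mem_nhds (phi_pos ha)), eventually_ge_atTop 0] with x hlt hx
  refine (phi_strictAntiOn.lt_iff_gt (checkMean_nonneg hj hx) ha).1 ?_
  rw [phi_checkMean hj hx]
  exact (checkMean_arg_mem hj hx).2.2.trans_lt hlt

/-! ### Moments of sech and two-sided bounds for `φ` -/

lemma inv_cosh_le (w : ℝ) : (cosh w)⁻¹ ≤ 2 * exp (-|w|) := by
  rw [← cosh_abs, exp_neg, ← div_eq_mul_inv, inv_le_comm₀ (cosh_pos _) (by positivity), inv_div,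
    cosh_eq]
  linarith [exp_pos (-|w|)]

lemma integral_exp_neg_abs : ∫ w : ℝ, 2 * exp (-|w|) = 4 := by
  rw [integral_comp_abs (f := fun w : ℝ => 2 * exp (-w)), integral_const_mul, integral_exp_neg_Ioi]
  norm_num

lemma integral_sq_mul_exp_neg_abs : ∫ w : ℝ, w ^ 2 * (2 * exp (-|w|)) = 8 := by
  have h := integral_comp_abs (f := fun w : ℝ => w ^ 2 * (2 * exp (-w)))
  simp only [sq_abs] at h
  have hG : Gamma 3 = 2 := by
    simp [Nat.factorial]
  rw [Gamma_eq_integral (by norm_num)] at hG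
  have h2 : ∫ w in Set.Ioi (0 : ℝ), w ^ 2 * (2 * exp (-w)) = 2 * 2 := by
    rw [← hG, ← integral_const_mul]
    refine setIntegral_congr_fun measurableSet_Ioi fun w _ => ?_
    norm_num
    ring
  rw [h, h2]
  norm_num

lemma integrable_sq_mul_exp_neg_abs : Integrable fun w : ℝ => w ^ 2 * (2 * exp (-|w|)) :=
  -- The integral of a non-integrable function is `0` by convention, so a nonzero value proves
  -- integrability.
  Integrable.of_integral_ne_zero (by rw [integral_sq_mul_exp_neg_abs]; norm_num)

lemma continuous_inv_cosh : Continuous fun w : ℝ => (cosh w)⁻¹ :=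
  Continuous.inv₀ (by fun_prop) fun w => (cosh_pos _).ne'

lemma integrable_inv_cosh : Integrable fun w : ℝ => (cosh w)⁻¹ := by
  have h : Integrable fun w : ℝ => 2 * exp (-|w|) :=
    Integrable.of_integral_ne_zero (by rw [integral_exp_neg_abs]; norm_num)
  refine h.mono' continuous_inv_cosh.aestronglyMeasurable (ae_of_all _ fun w => ?_)
  rw [norm_of_nonneg (inv_nonneg.2 (cosh_pos _).le)]
  exact inv_cosh_le w

lemma integral_inv_cosh : ∫ w : ℝ, (cosh w)⁻¹ = π := by
  have hderiv (w : ℝ) : HasDerivAt (fun w => arctan (sinh w)) (cosh w)⁻¹ w := by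
    convert (hasDerivAt_sinh w).arctan using 1
    rw [← cosh_sq' w]
    have := (cosh_pos w).ne'
    field_simp
  have hbot : Tendsto (fun w => arctan (sinh w)) atBot (𝓝 (-(π / 2))) :=
    (tendsto_nhds_of_tendsto_nhdsWithin tendsto_arctan_atBot).comp sinhOrderIso.tendsto_atBot
  have htop : Tendsto (fun w => arctan (sinh w)) atTop (𝓝 (π / 2)) :=
    (tendsto_nhds_of_tendsto_nhdsWithin tendsto_arctan_atTop).comp sinhOrderIso.tendsto_atTop
  rw [integral_of_hasDerivAt_of_tendsto hderiv integrable_inv_cosh hbot htop]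
  ring

lemma integrable_sq_mul_inv_cosh : Integrable fun w : ℝ => w ^ 2 * (cosh w)⁻¹ := by
  have := continuous_inv_cosh
  refine integrable_sq_mul_exp_neg_abs.mono' (by fun_prop) (ae_of_all _ fun w => ?_)
  have h0 : 0 ≤ (cosh w)⁻¹ := inv_nonneg.2 (cosh_pos _).le
  rw [norm_of_nonneg (by positivity)]
  exact mul_le_mul_of_nonneg_left (inv_cosh_le w) (sq_nonneg w)

/-- The crude bound `sech w ≤ 2 e^(-|w|)` already gives `8 < 3π`. This is the source of the `3` in
`δ_j`. -/
lemma integral_sq_mul_inv_cosh_le : ∫ w : ℝ, w ^ 2 * (cosh w)⁻¹ ≤ 3 * π := by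
  have h : ∫ w : ℝ, w ^ 2 * (cosh w)⁻¹ ≤ 8 := by
    rw [← integral_sq_mul_exp_neg_abs]
    exact integral_mono integrable_sq_mul_inv_cosh integrable_sq_mul_exp_neg_abs fun w =>
      mul_le_mul_of_nonneg_left (inv_cosh_le w) (sq_nonneg w)
  linarith [pi_gt_three]

/-- The substitution `w = √x v` moves `x` from the sech into a Gaussian factor that tends to `1` as
`x` grows. -/
lemma sqrt_mul_sechAverage {x : ℝ} (hx : 0 < x) :
    √x * sechAverage x = ∫ w : ℝ, (cosh w)⁻¹ * exp (-(w ^ 2 / x)) := by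
  have hs : 0 < √x := sqrt_pos.2 hx
  have := Measure.integral_comp_mul_left (fun w : ℝ => (cosh w)⁻¹ * exp (-(w ^ 2 / x))) √x
  rw [abs_of_pos (by positivity), smul_eq_mul] at this
  have h2 : sechAverage x = ∫ v : ℝ, (cosh (√x * v))⁻¹ * exp (-((√x * v) ^ 2 / x)) := by
    rw [sechAverage]
    congr 1
    ext v
    rw [mul_pow, sq_sqrt hx.le, mul_div_cancel_left₀ _ hx.ne']
  rw [h2, this, mul_inv_cancel_left₀ hs.ne']

lemma integrable_inv_cosh_mul_exp {x : ℝ} (hx : 0 < x) :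
    Integrable fun w : ℝ => (cosh w)⁻¹ * exp (-(w ^ 2 / x)) := by
  have := continuous_inv_cosh
  refine integrable_inv_cosh.mono' (by fun_prop) (ae_of_all _ fun w => ?_)
  have h0 : 0 ≤ (cosh w)⁻¹ := inv_nonneg.2 (cosh_pos _).le
  rw [norm_of_nonneg (by positivity)]
  exact mul_le_of_le_one_right h0 (exp_le_one_iff.2 (neg_nonpos.2 (by positivity)))

lemma sqrt_mul_sechAverage_le {x : ℝ} (hx : 0 < x) : √x * sechAverage x ≤ π := by
  rw [sqrt_mul_sechAverage hx, ← integral_inv_cosh]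
  refine integral_mono (integrable_inv_cosh_mul_exp hx) integrable_inv_cosh fun w => ?_
  exact mul_le_of_le_one_right (inv_nonneg.2 (cosh_pos _).le)
    (exp_le_one_iff.2 (neg_nonpos.2 (by positivity)))

/-- Integrate `e^(-t) ≥ 1 - t` at `t = w²/x` against sech: the zeroth moment is `π` and the second
at most `3π`. -/
lemma le_sqrt_mul_sechAverage {x : ℝ} (hx : 0 < x) : π * (1 - 3 / x) ≤ √x * sechAverage x := by
  rw [sqrt_mul_sechAverage hx]
  calc π * (1 - 3 / x) ≤ (∫ w : ℝ, (cosh w)⁻¹) - x⁻¹ * ∫ w : ℝ, w ^ 2 * (cosh w)⁻¹ := by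
        rw [integral_inv_cosh]
        have := mul_le_mul_of_nonneg_left integral_sq_mul_inv_cosh_le (inv_nonneg.2 hx.le)
        rw [div_eq_mul_inv]
        linarith
    _ = ∫ w : ℝ, ((cosh w)⁻¹ - x⁻¹ * (w ^ 2 * (cosh w)⁻¹)) := by
        rw [← integral_const_mul,
          integral_sub integrable_inv_cosh (integrable_sq_mul_inv_cosh.const_mul _)]
    _ ≤ _ := by
        refine integral_mono (integrable_inv_cosh.sub (integrable_sq_mul_inv_cosh.const_mul _))
          (integrable_inv_cosh_mul_exp hx) fun w => ?_
        have h0 : 0 ≤ (cosh w)⁻¹ := inv_nonneg.2 (cosh_pos _).le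
        have h1 := mul_le_mul_of_nonneg_left (add_one_le_exp (-(w ^ 2 / x))) h0
        refine le_trans (le_of_eq ?_) h1
        field_simp
        ring

/-- Bounding `√m S(m)` below and `√x S(x)` above leaves `e^((x-m)/4) ≤ k / (1 - 3/m)`. -/
lemma sub_le_log_of_phi_le {k m x : ℝ} (hm : 3 < m) (hmx : m ≤ x) (h : phi m ≤ k * phi x) :
    x - m ≤ 4 * log (k / (1 - 3 / m)) := by
  have hm0 : 0 < m := by linarith
  have hx0 : 0 < x := by linarith
  have hpi := sqrt_pos.2 pi_pos
  have hsm := sqrt_pos.2 hm0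
  have hsmx : √m ≤ √x := sqrt_le_sqrt hmx
  have hδ : 0 < 1 - 3 / m := by rw [sub_pos, div_lt_one hm0]; exact hm
  have hk : 0 < k := by
    by_contra hk
    nlinarith [phi_pos hm0.le, phi_pos hx0.le]
  rw [phi_eq_sechAverage hm0.le, phi_eq_sechAverage hx0.le] at h
  have h1 : exp (-m / 4) * sechAverage m ≤ k * (exp (-x / 4) * sechAverage x) := by
    refine le_of_mul_le_mul_right ?_ (inv_pos.2 hpi)
    calc _ = exp (-m / 4) / √π * sechAverage m := by ring
      _ ≤ k * (exp (-x / 4) / √π * sechAverage x) := h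
      _ = _ := by ring
  have h2 : exp (-m / 4) * (π * (1 - 3 / m)) ≤ k * exp (-x / 4) * π :=
    calc exp (-m / 4) * (π * (1 - 3 / m)) ≤ exp (-m / 4) * (√m * sechAverage m) :=
          mul_le_mul_of_nonneg_left (le_sqrt_mul_sechAverage hm0) (exp_pos _).le
      _ = √m * (exp (-m / 4) * sechAverage m) := by ring
      _ ≤ √m * (k * (exp (-x / 4) * sechAverage x)) := mul_le_mul_of_nonneg_left h1 hsm.le
      -- Here `m ≤ x` is what allows the factor `√(m/x)` to be dropped.
      _ ≤ √x * (k * (exp (-x / 4) * sechAverage x)) :=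
          mul_le_mul_of_nonneg_right hsmx
            (mul_nonneg hk.le (mul_nonneg (exp_pos _).le (sechAverage_pos x).le))
      _ = k * exp (-x / 4) * (√x * sechAverage x) := by ring
      _ ≤ _ := mul_le_mul_of_nonneg_left (sqrt_mul_sechAverage_le hx0) (by positivity)
  have h3 : exp ((x - m) / 4) ≤ k / (1 - 3 / m) := by
    rw [le_div_iff₀ hδ]
    have hfac : exp ((x - m) / 4) = exp (-m / 4) * exp (x / 4) := by
      rw [← exp_add]; congr 1; ring
    have hcancel : exp (-x / 4) * exp (x / 4) = 1 := by
      rw [← exp_add]; simp [neg_div]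
    have h4 : exp (-m / 4) * (1 - 3 / m) ≤ k * exp (-x / 4) :=
      le_of_mul_le_mul_right (by linarith) pi_pos
    calc _ = exp (-m / 4) * (1 - 3 / m) * exp (x / 4) := by rw [hfac]; ring
      _ ≤ k * exp (-x / 4) * exp (x / 4) := mul_le_mul_of_nonneg_right h4 (exp_pos _).le
      _ = k := by rw [mul_assoc, hcancel, mul_one]
  have := (le_log_iff_exp_le (by positivity)).2 h3
  linarith

lemma sub_checkMean_le {j : ℕ} (hj : 2 ≤ j) {x : ℝ} (hx : 0 ≤ x) (hm : 3 < checkMean j x) :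
    x - checkMean j x ≤ 4 * log (((j : ℝ) - 1) / (1 - 3 / checkMean j x)) :=
  sub_le_log_of_phi_le hm (checkMean_le_self hj hx)
    ((phi_checkMean hj hx).trans_le (checkMean_arg_mem hj hx).2.2)

/-! ### Growth of the recursion -/

section Recursion

variable {dv dr : ℕ} {ρ : ℕ → ℝ} {R e : ℝ}

lemma variableMean_nonneg (hdv : 3 ≤ dv) {a m : ℝ} (ha : 0 ≤ a) (hm : 0 ≤ m) :
    0 ≤ variableMean dv a m := by
  have : (3 : ℝ) ≤ dv := by exact_mod_cast hdv
  exact add_nonneg ha (mul_nonneg (by linarith) hm)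

lemma mean_succ (l : ℕ) : mean dv dr ρ R e (l + 1) =
    ∑ j ∈ Finset.Icc 2 dr, ρ j * degreeMean dv dr ρ R e j (l + 1) := rfl

lemma mean_nonneg (hdv : 3 ≤ dv) (hρ : ∀ j ∈ Finset.Icc 2 dr, 0 ≤ ρ j) (hRe : 0 ≤ channelMean R e)
    (l : ℕ) : 0 ≤ mean dv dr ρ R e l := by
  induction l with
  | zero => exact le_rfl
  | succ l ih =>
    exact Finset.sum_nonneg fun j hj => mul_nonneg (hρ j hj)
      (checkMean_nonneg (Finset.mem_Icc.1 hj).1 (variableMean_nonneg hdv hRe ih))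

lemma mean_monotone (hdv : 3 ≤ dv) (hρ : ∀ j ∈ Finset.Icc 2 dr, 0 ≤ ρ j)
    (hRe : 0 ≤ channelMean R e) : Monotone (mean dv dr ρ R e) := by
  refine monotone_nat_of_le_succ fun l => ?_
  have hdv' : (3 : ℝ) ≤ dv := by exact_mod_cast hdv
  induction l with
  | zero => exact mean_nonneg hdv hρ hRe 1
  | succ l ih =>
    refine Finset.sum_le_sum fun j hj => mul_le_mul_of_nonneg_left ?_ (hρ j hj)
    exact checkMean_mono (Finset.mem_Icc.1 hj).1
      (variableMean_nonneg hdv hRe (mean_nonneg hdv hρ hRe l))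
      (add_le_add le_rfl (mul_le_mul_of_nonneg_left ih (by linarith)))

lemma degreeMean_monotone (hdv : 3 ≤ dv) (hρ : ∀ j ∈ Finset.Icc 2 dr, 0 ≤ ρ j)
    (hRe : 0 ≤ channelMean R e) {j : ℕ} (hj : 2 ≤ j) : Monotone (degreeMean dv dr ρ R e j) := by
  have hdv' : (3 : ℝ) ≤ dv := by exact_mod_cast hdv
  refine monotone_nat_of_le_succ fun l => ?_
  cases l with
  | zero => exact checkMean_nonneg hj (variableMean_nonneg hdv hRe le_rfl)
  | succ l =>
    exact checkMean_mono hj (variableMean_nonneg hdv hRe (mean_nonneg hdv hρ hRe l))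
      (add_le_add le_rfl
        (mul_le_mul_of_nonneg_left (mean_monotone hdv hρ hRe l.le_succ) (by linarith)))

/-- Each `m_j` is nondecreasing in `l`, hence so is `δ_j`, and the logarithmic sum can only shrink.
-/
lemma GrowthCondition.of_le (hdv : 3 ≤ dv) (hρ : ∀ j ∈ Finset.Icc 2 dr, 0 ≤ ρ j)
    (hRe : 0 ≤ channelMean R e) {l l' : ℕ} (hl : l ≤ l') (h : GrowthCondition dv dr ρ R e l) :
    GrowthCondition dv dr ρ R e l' := by
  refine ⟨fun j hj hj0 => (h.1 j hj hj0).trans_le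
    (degreeMean_monotone hdv hρ hRe (Finset.mem_Icc.1 hj).1 hl), lt_of_le_of_lt ?_ h.2⟩
  refine Finset.sum_le_sum fun j hj => ?_
  by_cases hj0 : ρ j = 0
  · simp [hj0]
  have hj2 : (2 : ℝ) ≤ j := by exact_mod_cast (Finset.mem_Icc.1 hj).1
  have hm := h.1 j hj hj0
  have hmm : degreeMean dv dr ρ R e j l ≤ degreeMean dv dr ρ R e j l' :=
    degreeMean_monotone hdv hρ hRe (Finset.mem_Icc.1 hj).1 hl
  have hδ : 0 < delta dv dr ρ R e j l := by
    rw [delta, sub_pos, div_lt_one (by linarith)]; exact hm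
  have hδδ : delta dv dr ρ R e j l ≤ delta dv dr ρ R e j l' :=
    sub_le_sub_left (div_le_div_of_nonneg_left (by norm_num) (by linarith) hmm) _
  refine mul_le_mul_of_nonneg_left (log_le_log ?_ ?_) (hρ j hj)
  · exact div_pos (by linarith) (hδ.trans_le hδδ)
  · exact div_le_div_of_nonneg_left (by linarith) hδ hδδ

lemma GrowthCondition.mul_mean_lt (hdv : 3 ≤ dv) (hρ : ∀ j ∈ Finset.Icc 2 dr, 0 ≤ ρ j)
    (hρ_sum : ∑ j ∈ Finset.Icc 2 dr, ρ j = 1) (hRe : 0 ≤ channelMean R e) {l : ℕ}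
    (h : GrowthCondition dv dr ρ R e (l + 1)) :
    ((dv : ℝ) - 1) * mean dv dr ρ R e l < mean dv dr ρ R e (l + 1) := by
  set x := variableMean dv (channelMean R e) (mean dv dr ρ R e l) with hx
  have hx0 : 0 ≤ x := variableMean_nonneg hdv hRe (mean_nonneg hdv hρ hRe l)
  have hsum : x - mean dv dr ρ R e (l + 1) ≤ 4 * ∑ j ∈ Finset.Icc 2 dr,
      ρ j * log (((j : ℝ) - 1) / delta dv dr ρ R e j (l + 1)) := by
    calc x - mean dv dr ρ R e (l + 1) =
          ∑ j ∈ Finset.Icc 2 dr, ρ j * (x - degreeMean dv dr ρ R e j (l + 1)) := by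
          simp_rw [mul_sub, Finset.sum_sub_distrib, ← Finset.sum_mul, hρ_sum, one_mul, mean_succ]
      _ ≤ ∑ j ∈ Finset.Icc 2 dr,
          4 * (ρ j * log (((j : ℝ) - 1) / delta dv dr ρ R e j (l + 1))) := by
          refine Finset.sum_le_sum fun j hj => ?_
          -- For absent degrees `m_j > 3` may fail, but their terms vanish.
          by_cases hj0 : ρ j = 0
          · simp [hj0]
          rw [mul_left_comm]
          exact mul_le_mul_of_nonneg_left
            (sub_checkMean_le (Finset.mem_Icc.1 hj).1 hx0 (h.1 j hj hj0)) (hρ j hj)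
      _ = _ := (Finset.mul_sum _ _ _).symm
  have h2 := h.2
  have hxe : x = 4 * R * e + ((dv : ℝ) - 1) * mean dv dr ρ R e l := rfl
  linarith

lemma le_mean_of_forall_le {a : ℝ} (hρ : ∀ j ∈ Finset.Icc 2 dr, 0 ≤ ρ j)
    (hρ_sum : ∑ j ∈ Finset.Icc 2 dr, ρ j = 1) {l : ℕ}
    (h : ∀ j ∈ Finset.Icc 2 dr, ρ j ≠ 0 → a ≤ degreeMean dv dr ρ R e j (l + 1)) :
    a ≤ mean dv dr ρ R e (l + 1) := by
  rw [mean_succ, ← one_mul a, ← hρ_sum, Finset.sum_mul]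
  refine Finset.sum_le_sum fun j hj => ?_
  by_cases hj0 : ρ j = 0
  · simp [hj0]
  · exact mul_le_mul_of_nonneg_left (h j hj hj0) (hρ j hj)

lemma GrowthCondition.lt_mean (hdv : 3 ≤ dv) (hρ : ∀ j ∈ Finset.Icc 2 dr, 0 ≤ ρ j)
    (hρ_sum : ∑ j ∈ Finset.Icc 2 dr, ρ j = 1) (hRe : 0 ≤ channelMean R e) {l₀ : ℕ} (hl₀ : 1 ≤ l₀)
    (h : GrowthCondition dv dr ρ R e l₀) {l : ℕ} (hl : l₀ ≤ l) :
    2 * ((dv : ℝ) - 1) ^ (l - l₀) < mean dv dr ρ R e l := by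
  have hdv' : (3 : ℝ) ≤ dv := by exact_mod_cast hdv
  induction l, hl using Nat.le_induction with
  | base =>
    obtain ⟨k, rfl⟩ := Nat.exists_eq_add_of_le' hl₀
    -- Averaging yields only `3 ≤ m^(l₀)`; the constant `2` makes the starting inequality strict.
    have := le_mean_of_forall_le hρ hρ_sum fun j hj hj0 => (h.1 j hj hj0).le
    simp only [tsub_self, pow_zero]
    linarith
  | succ l hl ih =>
    have := (h.of_le hdv hρ hRe (hl.trans l.le_succ)).mul_mean_lt hdv hρ hρ_sum hRe
    rw [Nat.succ_sub hl, pow_succ]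
    nlinarith

lemma GrowthCondition.mul_pow_lt_mean (hdv : 3 ≤ dv) (hρ : ∀ j ∈ Finset.Icc 2 dr, 0 ≤ ρ j)
    (hρ_sum : ∑ j ∈ Finset.Icc 2 dr, ρ j = 1) (hRe : 0 ≤ channelMean R e) {l₀ : ℕ} (hl₀ : 1 ≤ l₀)
    (h : GrowthCondition dv dr ρ R e l₀) {l : ℕ} (hl : l₀ ≤ l) :
    2 / ((dv : ℝ) - 1) ^ l₀ * ((dv : ℝ) - 1) ^ l < mean dv dr ρ R e l := by
  have hdv' : (3 : ℝ) ≤ dv := by exact_mod_cast hdv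
  have hpos : (0 : ℝ) < (dv : ℝ) - 1 := by linarith
  convert h.lt_mean hdv hρ hρ_sum hRe hl₀ hl using 1
  rw [pow_sub₀ _ hpos.ne' hl]
  field_simp

/-- Since `m^(0) = 0`, the first check input is the channel mean alone, which tends to infinity with
`e`. -/
lemma eventually_growthCondition_one (hρ : ∀ j ∈ Finset.Icc 2 dr, 0 ≤ ρ j)
    (hR : 0 < R) : ∀ᶠ e in atTop, GrowthCondition dv dr ρ R e 1 := by
  have hx : Tendsto (fun e => variableMean dv (channelMean R e) 0) atTop atTop := by
    simp only [variableMean, channelMean, mul_zero, add_zero]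
    exact tendsto_id.const_mul_atTop (by positivity)
  -- `m_j > 6` forces `δ_j ≥ 1/2`, so the logarithmic sum is bounded independently of `e`, while `R
  -- e` is unbounded.
  have hlarge : ∀ᶠ e in atTop, ∀ j ∈ Finset.Icc 2 dr, 6 < degreeMean dv dr ρ R e j 1 :=
    (Finset.eventually_all _).2 fun j hj =>
      hx.eventually (eventually_lt_checkMean (Finset.mem_Icc.1 hj).1 (by norm_num))
  have hRe : Tendsto (fun e => R * e) atTop atTop := tendsto_id.const_mul_atTop hR
  filter_upwards [hlarge, hRe.eventually (eventually_gt_atTop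
    (∑ j ∈ Finset.Icc 2 dr, ρ j * log (((j : ℝ) - 1) / (1 / 2))))] with e he hlt
  refine ⟨fun j hj _ => by linarith [he j hj], lt_of_le_of_lt ?_ hlt⟩
  refine Finset.sum_le_sum fun j hj => mul_le_mul_of_nonneg_left ?_ (hρ j hj)
  have hj2 : (2 : ℝ) ≤ j := by exact_mod_cast (Finset.mem_Icc.1 hj).1
  have hm := he j hj
  have hδ : 1 / 2 ≤ delta dv dr ρ R e j 1 := by
    have : 3 / degreeMean dv dr ρ R e j 1 ≤ 1 / 2 := by
      rw [div_le_iff₀ (by linarith)]; linarith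
    rw [delta]; linarith
  refine log_le_log (div_pos (by linarith) (by linarith)) ?_
  exact div_le_div_of_nonneg_left (by linarith) (by norm_num) hδ

end Recursion

end DensityEvolution

theorem mainTheorem7 (dv dr : ℕ) (ρ : ℕ → ℝ) (R : ℝ)
    (hdv : 3 ≤ dv)
    (hρ_nonneg : ∀ j ∈ Finset.Icc 2 dr, 0 ≤ ρ j)
    (hρ_sum : ∑ j ∈ Finset.Icc 2 dr, ρ j = 1)
    (hR : 0 < R) :
    -- growth at sufficiently high `E_b / N_0`, where the SNR condition is met
    (∃ e₀ : ℝ, 0 < e₀ ∧ ∃ C : ℝ, 0 < C ∧ ∀ e : ℝ, e₀ < e → ∃ L : ℕ, 1 ≤ L ∧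
      DensityEvolution.GrowthCondition dv dr ρ R e L ∧
      ∀ l : ℕ, L ≤ l → C * ((dv : ℝ) - 1) ^ l < DensityEvolution.mean dv dr ρ R e l) ∧
    -- the SNR condition at a single iteration `l₀` suffices for growth from there on
    (∀ e : ℝ, 0 < e → ∀ l₀ : ℕ, 1 ≤ l₀ → DensityEvolution.GrowthCondition dv dr ρ R e l₀ →
      (∀ l : ℕ, l₀ ≤ l →
        ((dv : ℝ) - 1) * DensityEvolution.mean dv dr ρ R e (l - 1) <
          DensityEvolution.mean dv dr ρ R e l) ∧
      ∃ C : ℝ, 0 < C ∧ ∀ l : ℕ, l₀ ≤ l →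
        C * ((dv : ℝ) - 1) ^ l < DensityEvolution.mean dv dr ρ R e l) := by
  have hdv' : (3 : ℝ) ≤ dv := by exact_mod_cast hdv
  have hC (l : ℕ) : (0 : ℝ) < 2 / ((dv : ℝ) - 1) ^ l :=
    div_pos two_pos (pow_pos (by linarith) l)
  have hRe {e : ℝ} (he : 0 < e) : 0 ≤ DensityEvolution.channelMean R e := by
    rw [DensityEvolution.channelMean]; positivity
  constructor
  · obtain ⟨e₁, he₁⟩ := eventually_atTop.1
      (DensityEvolution.eventually_growthCondition_one (dv := dv) hρ_nonneg hR)
    -- The condition holds at `L = 1` for every such `e`, so `C = 2/(d_v-1)` does not depend on `e`.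
    -- The maximum with `1` keeps the threshold positive.
    refine ⟨max e₁ 1, lt_max_of_lt_right one_pos, _, hC 1, fun e he => ?_⟩
    have hG := he₁ e ((le_max_left _ _).trans he.le)
    have he0 : 0 < e := one_pos.trans ((le_max_right _ _).trans_lt he)
    exact ⟨1, le_rfl, hG, fun l hl =>
      hG.mul_pow_lt_mean hdv hρ_nonneg hρ_sum (hRe he0) le_rfl hl⟩
  · intro e he l₀ hl₀ hG
    refine ⟨fun l hl => ?_, _, hC l₀, fun l hl =>
      hG.mul_pow_lt_mean hdv hρ_nonneg hρ_sum (hRe he) hl₀ hl⟩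
    obtain ⟨k, rfl⟩ := Nat.exists_eq_add_of_le' (hl₀.trans hl)
    exact (hG.of_le hdv hρ_nonneg (hRe he) hl).mul_mean_lt hdv hρ_nonneg hρ_sum (hRe he)
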